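/- Let $H$ be a real Hilbert space with unit sphere $S(H)$, and let $f\colon H\to\mathbb{R}$ be a Lipschitz function whose smallest Lipschitz constant $\mathrm{Lip}(f)$ is positive. Write $f'(y,u)=\lim_{t\to0}\frac{f(y+tu)-f(y)}{t}$ for the (two-sided) directional derivative when this limit exists, and $[y,z]$ for the closed line segment joining $y,z\in H$. Let $\varepsilon\in(0,\mathrm{Lip}(f)/9)$. Suppose $x\in H$, $e\in S(H)$ and $s>0$ are such that $f'(x,e)$ exists, is non-negative, and $$|f(x+te)-f(x)-f'(x,e)t|\le\frac{\varepsilon^2}{160\,\mathrm{Lip}(f)}|t|\qquad\text{for all real } t \text{ with } |t|\le s\sqrt{\frac{2\,\mathrm{Lip}(f)}{\varepsilon}}.$$ Suppose further that $\xi\in(-s/2,s/2)$ and $\lambda\in H$ satisfy $$|f(x+\lambda)-f(x+\xi e)|\ge240\,\varepsilon s,\qquad \|\lambda-\xi e\|\le s\sqrt{\frac{\varepsilon}{\mathrm{Lip}(f)}},$$ $$\frac{\|\pi se+\lambda\|}{|\pi s+\xi|}\le1+\frac{\varepsilon}{4\,\mathrm{Lip}(f)}\qquad\text{for } \pi=1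 \text{ and } \pi=-1.$$ Then for all $s_1,s_2,\lambda'\in H$ with $$\max(\|s_1-se\|,\|s_2-se\|)\le\frac{\varepsilon^2}{320\,\mathrm{Lip}(f)^2}\,s\qquad\text{and}\qquad\|\lambda'-\lambda\|\le\frac{\varepsilon s}{16\,\mathrm{Lip}(f)},$$ there exist $x'\in[x-s_1,x+\lambda']\cup[x+\lambda',x+s_2]$ and $e'\in S(H)$ such that the directional derivative $f'(x',e')$ exists, $$f'(x',e')\ge f'(x,e)+\varepsilon,$$ and, for all $t\in\mathbb{R}$, $$|(f(x'+te)-f(x'))-(f(x+te)-f(x))|\le25\sqrt{(f'(x',e')-f'(x,e))\,\mathrm{Lip}(f)}\,|t|.$$ -/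

import Mathlib

open scoped NNReal

noncomputable section

/-- `lipConst f` is `Lip(f)`, the smallest `L ≥ 0` with `‖f x - f y‖ ≤ L * ‖x - y‖` for all `x, y`
(for a Lipschitz map `f`; see `isLeast_lipConst`). -/
def lipConst {X Y : Type*} [NormedAddCommGroup X] [NormedAddCommGroup Y] (f : X → Y) : ℝ :=
  sInf {L : ℝ | 0 ≤ L ∧ ∀ x y : X, ‖f x - f y‖ ≤ L * ‖x - y‖}

theorem isLeast_lipConst {X Y : Type*} [NormedAddCommGroup X] [NormedAddCommGroup Y] {f : X → Y}
    {K : ℝ≥0} (hf : LipschitzWith K f) :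
    IsLeast {L : ℝ | 0 ≤ L ∧ ∀ x y : X, ‖f x - f y‖ ≤ L * ‖x - y‖} (lipConst f) := by
  have hne : {L : ℝ | 0 ≤ L ∧ ∀ x y : X, ‖f x - f y‖ ≤ L * ‖x - y‖}.Nonempty :=
    ⟨K, K.2, fun x y => hf.norm_sub_le x y⟩
  have hbdd : BddBelow {L : ℝ | 0 ≤ L ∧ ∀ x y : X, ‖f x - f y‖ ≤ L * ‖x - y‖} :=
    ⟨0, fun L hL => hL.1⟩
  refine IsClosed.isLeast_csInf ?_ hne hbdd
  simp only [Set.setOf_and, Set.setOf_forall]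
  refine (isClosed_le continuous_const continuous_id).inter
    (isClosed_iInter fun x => isClosed_iInter fun y => ?_)
  exact isClosed_le continuous_const (continuous_id.mul continuous_const)

end

/-! Put `r = √(ε / Lip f)` and let `γ` be the broken line that is at `-s₁`, `λ'`, `s₂` at times
`-s`, `ξ`, `s`. Its velocities are within `3r` of `e` and have norm at most `1 + r²/2`. The function
`h t = f (x + γ t) - f'(x,e) t` is almost equal to `f x` at both ends, but differs from it by at
least `239 ε s` at `ξ`. So `h` has large variation and small net increment, and about half of that
variation comes from `h' > 0`.

If every interior point with `h' ≥ c` had a difference quotient above `16 √(Λ h')`, the maximal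
inequality `volume_setOf_lt_slope_le` would bound the measure of `{h' > α}` by a multiple of
`1/√(Λα)`. This is integrable on `(0, Λ]`, and the layer-cake formula would make `∫ max h' 0` too
small. Hence `exists_le_deriv_and_slope_le` yields a good time `τ`.

`abs_sub_increment_le` transfers the slope bound from `γ` to the line in direction `e`, with an
extra error `4 r Lip(f) |t|`. Normalising the velocity at `τ` to a unit vector costs at most `ε/2`
of the derivative, which is covered by taking `c = 3ε`. -/

/-! ### Real functions: maximal inequality and choice of a good point. -/

open MeasureTheory Set in
/-- Weak-type maximal inequality for the difference quotients of a Lipschitz function. -/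
theorem volume_setOf_lt_slope_le {h : ℝ → ℝ} {K : ℝ≥0} (hh : LipschitzWith K h) {a b β : ℝ}
    (hβ : 0 < β) :
    volume {τ ∈ Icc a b | ∃ t ∈ Icc a b, β * |t - τ| < |h t - h τ|} ≤
      ENNReal.ofReal (7 / 2 / β) * ∫⁻ x in Icc a b, ‖deriv h x‖ₑ := by
  set E := {τ ∈ Icc a b | ∃ t ∈ Icc a b, β * |t - τ| < |h t - h τ|} with hE
  have hex : ∀ τ : ℝ, ∃ t : ℝ, τ ∈ E → t ∈ Icc a b ∧ β * |t - τ| < |h t - h τ| := by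
    intro τ
    by_cases hτ : τ ∈ E
    · obtain ⟨t, ht⟩ := hτ.2
      exact ⟨t, fun _ => ht⟩
    · exact ⟨0, fun h => absurd h hτ⟩
  choose t ht using hex
  have hball : ∀ τ, Metric.closedBall ((τ + t τ) / 2) (|t τ - τ| / 2) = uIcc τ (t τ) := by
    intro τ
    rw [Real.closedBall_eq_Icc, uIcc]
    rcases le_total τ (t τ) with h | h
    · rw [abs_of_nonneg (by linarith), inf_eq_left.2 h, sup_eq_right.2 h]
      congr 1 <;> ring
    · rw [abs_of_nonpos (by linarith), inf_eq_right.2 h, sup_eq_left.2 h]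
      congr 1 <;> ring
  have hpos : ∀ τ ∈ E, 0 < |t τ - τ| := by
    intro τ hτ
    refine abs_pos.2 fun h0 => ?_
    have := (ht τ hτ).2
    rw [sub_eq_zero.1 h0] at this
    simp at this
  -- The balls are the intervals between `τ` and its witness `t τ`. The factor 7/2 is a choice:
  -- Vitali covering needs a ratio above 3.
  obtain ⟨u, huE, hdisj, hcov⟩ := Vitali.exists_disjoint_subfamily_covering_enlargement_closedBall
    E (fun τ => (τ + t τ) / 2) (fun τ => |t τ - τ| / 2) (b - a) (by
      intro τ hτ
      have h1 := hτ.1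
      have h2 := (ht τ hτ).1
      have : |t τ - τ| ≤ b - a := abs_sub_le_iff.2 ⟨by linarith [h1.1, h2.2], by
        linarith [h1.2, h2.1]⟩
      linarith [abs_nonneg (t τ - τ)]) (7 / 2) (by norm_num)
  have hucount : u.Countable := by
    refine hdisj.countable_of_nonempty_interior fun τ hτ => ?_
    have := hpos τ (huE hτ)
    exact ⟨(τ + t τ) / 2, Metric.ball_subset_interior_closedBall
      (Metric.mem_ball_self (by positivity))⟩
  have hsub : E ⊆ ⋃ τ ∈ u, Metric.closedBall ((τ + t τ) / 2) (7 / 2 * (|t τ - τ| / 2)) := by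
    intro τ hτ
    obtain ⟨σ, hσ, hs⟩ := hcov τ hτ
    refine mem_biUnion hσ (hs ?_)
    rw [hball]
    exact left_mem_uIcc
  have hone : ∀ τ ∈ u, volume (Metric.closedBall ((τ + t τ) / 2) (7 / 2 * (|t τ - τ| / 2))) ≤
      ENNReal.ofReal (7 / 2 / β) *
        ∫⁻ x in Metric.closedBall ((τ + t τ) / 2) (|t τ - τ| / 2), ‖deriv h x‖ₑ := by
    intro τ hτ
    have h1 := (ht τ (huE hτ)).2
    have hftc : ∫ x in τ..(t τ), deriv h x = h (t τ) - h τ :=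
      (hh.lipschitzOnWith.absolutelyContinuousOnInterval).integral_deriv_eq_sub
    have h2 : ENNReal.ofReal |h (t τ) - h τ| ≤ ∫⁻ x in uIcc τ (t τ), ‖deriv h x‖ₑ := by
      rw [← hftc, ← Real.norm_eq_abs, intervalIntegral.norm_integral_eq_norm_integral_uIoc,
        ofReal_norm]
      exact (enorm_integral_le_lintegral_enorm _).trans (lintegral_mono_set uIoc_subset_uIcc)
    rw [hball, Real.volume_closedBall]
    refine le_trans ?_ (mul_le_mul_right h2 _)
    rw [← ENNReal.ofReal_mul (by positivity)]
    apply ENNReal.ofReal_le_ofReal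
    rw [div_mul_eq_mul_div (7 / 2) β, le_div_iff₀ hβ]
    linarith
  calc volume E ≤ ∑' τ : u, volume
        (Metric.closedBall (((τ : ℝ) + t τ) / 2) (7 / 2 * (|t τ - τ| / 2))) :=
        (measure_mono hsub).trans (measure_biUnion_le _ hucount _)
    _ ≤ ∑' τ : u, ENNReal.ofReal (7 / 2 / β) *
        ∫⁻ x in Metric.closedBall (((τ : ℝ) + t τ) / 2) (|t τ - τ| / 2), ‖deriv h x‖ₑ :=
        ENNReal.tsum_le_tsum fun τ => hone τ τ.2
    _ = ENNReal.ofReal (7 / 2 / β) *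
        ∫⁻ x in ⋃ τ ∈ u, Metric.closedBall ((τ + t τ) / 2) (|t τ - τ| / 2), ‖deriv h x‖ₑ := by
        rw [ENNReal.tsum_mul_left,
          lintegral_biUnion hucount (fun τ _ => Metric.isClosed_closedBall.measurableSet) hdisj]
    _ ≤ _ := by
        gcongr
        refine iUnion₂_subset fun τ hτ => ?_
        rw [hball]
        exact uIcc_subset_Icc (huE hτ).1 (ht τ (huE hτ)).1

open MeasureTheory Set in
theorem integral_inv_sqrt {Λ : ℝ} (hΛ : 0 < Λ) :
    IntegrableOn (fun α : ℝ => (√(Λ * α))⁻¹) (Ioc 0 Λ) ∧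
      ∫ α in Ioc 0 Λ, (√(Λ * α))⁻¹ = 2 := by
  have heq : ∀ α ∈ Ioc 0 Λ, (√Λ)⁻¹ * α ^ (-(1 / 2) : ℝ) = (√(Λ * α))⁻¹ := by
    intro α hα
    rw [Real.sqrt_mul hΛ.le, mul_inv, Real.rpow_neg hα.1.le, Real.sqrt_eq_rpow α]
  have hint : IntervalIntegrable (fun α : ℝ => (√Λ)⁻¹ * α ^ (-(1 / 2) : ℝ)) volume 0 Λ :=
    (intervalIntegral.intervalIntegrable_rpow' (by norm_num)).const_mul _
  constructor
  · exact ((intervalIntegrable_iff_integrableOn_Ioc_of_le hΛ.le).1 hint).congr_fun heq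
      measurableSet_Ioc
  · rw [← setIntegral_congr_fun measurableSet_Ioc heq, ← intervalIntegral.integral_of_le hΛ.le,
      intervalIntegral.integral_const_mul, integral_rpow (Or.inl (by norm_num))]
    rw [show (-(1 / 2) + 1 : ℝ) = 1 / 2 by norm_num, ← Real.sqrt_eq_rpow, Real.zero_rpow (by norm_num)]
    have := (Real.sqrt_pos.2 hΛ).ne'
    field_simp
    norm_num

/-- `Λ * y - h y` is monotone. Where `h` is not differentiable, `deriv` is 0, hence the assumption
`0 ≤ Λ`. -/
theorem deriv_le_of_sub_le {h : ℝ → ℝ} {Λ : ℝ} (hΛ : 0 ≤ Λ)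
    (hup : ∀ x y, x ≤ y → h y - h x ≤ Λ * (y - x)) (τ : ℝ) : deriv h τ ≤ Λ := by
  by_cases hd : DifferentiableAt ℝ h τ
  · have hm : Monotone (fun y => Λ * y - h y) := fun x y hxy => by
      have := hup x y hxy
      simp only
      linarith
    have h1 : HasDerivAt (fun y => Λ * y - h y) (Λ - deriv h τ) τ := by
      have := ((hasDerivAt_id τ).const_mul Λ).sub hd.hasDerivAt
      rwa [mul_one] at this
    have h2 := hm.deriv_nonneg (x := τ)
    rw [h1.deriv] at h2
    linarith
  · rw [deriv_zero_of_not_differentiableAt hd]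
    exact hΛ

open MeasureTheory Set in
/-- A Lipschitz function which oscillates enough on an interval, compared to the difference of its
boundary values, has a point of differentiability with large derivative at which all difference
quotients are controlled by the square root of the derivative. -/
theorem exists_le_deriv_and_slope_le {h : ℝ → ℝ} {K : ℝ≥0} (hh : LipschitzWith K h)
    {a b ξ c δ Λ : ℝ} (hξ : ξ ∈ Icc a b) (hc : 0 ≤ c) (hδ : 0 ≤ δ) (hΛ : 0 < Λ)
    (hup : ∀ x y, x ≤ y → h y - h x ≤ Λ * (y - x))
    (hbig : 16 * (c * (b - a) + 2 * δ * Λ) + 8 * |h b - h a| < |h ξ - h a| + |h ξ - h b|) :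
    ∃ τ ∈ Ioo (a + δ) (b - δ), τ ≠ ξ ∧ c ≤ deriv h τ ∧
      ∀ t ∈ Icc a b, |h t - h τ| ≤ 16 * √(Λ * deriv h τ) * |t - τ| := by
  by_contra! H
  have hab : a ≤ b := hξ.1.trans hξ.2
  have hftc : ∀ p q : ℝ, ∫ x in p..q, deriv h x = h q - h p := fun p q =>
    (hh.lipschitzOnWith.absolutelyContinuousOnInterval).integral_deriv_eq_sub
  have hii : ∀ p q : ℝ, IntervalIntegrable (deriv h) volume p q := fun p q =>
    (hh.lipschitzOnWith.absolutelyContinuousOnInterval).intervalIntegrable_deriv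
  have hint : IntegrableOn (deriv h) (Icc a b) :=
    (intervalIntegrable_iff_integrableOn_Icc_of_le hab).1 (hii a b)
  set V := ∫ x in Icc a b, |deriv h x| with hV
  have hV0 : 0 ≤ V := integral_nonneg fun x => abs_nonneg _
  have hVint : V = ∫ x in a..b, |deriv h x| := by
    rw [hV, integral_Icc_eq_integral_Ioc, intervalIntegral.integral_of_le hab]
  have hVen : ∫⁻ x in Icc a b, ‖deriv h x‖ₑ = ENNReal.ofReal V := by
    rw [hV, ofReal_integral_eq_lintegral_ofReal hint.abs (ae_of_all _ fun x => abs_nonneg _)]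
    simp [← ofReal_norm]
  have hVlow : |h ξ - h a| + |h ξ - h b| ≤ V := by
    rw [hVint, ← intervalIntegral.integral_add_adjacent_intervals (hii a ξ).abs (hii ξ b).abs,
      abs_sub_comm (h ξ) (h b), ← hftc, ← hftc]
    exact add_le_add (intervalIntegral.abs_integral_le_integral_abs hξ.1)
      (intervalIntegral.abs_integral_le_integral_abs hξ.2)
  set g : ℝ → ℝ := fun x => max (deriv h x) 0 with hg
  have hgint : IntegrableOn g (Icc a b) := hint.pos_part
  -- The positive part carries half the variation, up to half the net increment.
  have hgeq : ∫ x in Icc a b, g x = (V + (h b - h a)) / 2 := by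
    have h1 : ∀ x, g x = (|deriv h x| + deriv h x) / 2 := by
      intro x
      simp only [hg]
      rcases le_total 0 (deriv h x) with h0 | h0
      · rw [max_eq_left h0, abs_of_nonneg h0]; ring
      · rw [max_eq_right h0, abs_of_nonpos h0]; ring
    simp_rw [h1]
    rw [integral_div, integral_add hint.abs hint, ← hV, integral_Icc_eq_integral_Ioc (f := deriv h),
      ← intervalIntegral.integral_of_le hab, hftc]
  have hcake : ENNReal.ofReal (∫ x in Icc a b, g x) =
      ∫⁻ α in Ioi 0, volume.restrict (Icc a b) {x | α < g x} := by
    rw [ofReal_integral_eq_lintegral_ofReal hgint (ae_of_all _ fun x => le_max_right _ _)]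
    exact lintegral_eq_lintegral_meas_lt _ (ae_of_all _ fun x => le_max_right _ _)
      hgint.aemeasurable
  -- Majorant of the measure of `{g > α}`: trivial for `α ≤ c`, otherwise end strips plus the
  -- maximal inequality, with `7/32 = (7/2)/16`. Its integral contains `7/16 * V`, and the gap to `V
  -- / 2` gives the contradiction.
  set G : ℝ → ℝ := fun α =>
    (Ioc 0 c).indicator (fun _ => b - a) α + 2 * δ + 7 / 32 * V * (√(Λ * α))⁻¹ with hG
  have hi0 : ∀ α, 0 ≤ (Ioc 0 c).indicator (fun _ => b - a) α := fun α =>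
    indicator_nonneg (fun _ _ => by linarith) α
  have hpt : ∀ α ∈ Ioi (0 : ℝ), volume.restrict (Icc a b) {x | α < g x} ≤
      (Ioc 0 Λ).indicator (fun α => ENNReal.ofReal (G α)) α := by
    intro α hα
    have hα' : 0 < α := hα
    have hlt : ∀ x, α < g x → α < deriv h x := fun x hx => by
      rcases lt_max_iff.1 hx with h | h
      · exact h
      · linarith
    by_cases hαΛ : α ≤ Λ
    · rw [indicator_of_mem (show α ∈ Ioc 0 Λ from ⟨hα, hαΛ⟩)]
      by_cases hαc : α ≤ c
      · calc volume.restrict (Icc a b) {x | α < g x} ≤ volume.restrict (Icc a b) univ :=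
              measure_mono (subset_univ _)
          _ = ENNReal.ofReal (b - a) := by simp
          _ ≤ ENNReal.ofReal (G α) := by
              apply ENNReal.ofReal_le_ofReal
              simp only [hG]
              rw [indicator_of_mem (show α ∈ Ioc 0 c from ⟨hα, hαc⟩)]
              have : 0 ≤ 7 / 32 * V * (√(Λ * α))⁻¹ := by positivity
              linarith
      · push Not at hαc
        have hβ : 0 < 16 * √(Λ * α) := by positivity
        have hsub : {x | α < g x} ∩ Icc a b ⊆ (Icc a (a + δ) ∪ Icc (b - δ) b ∪ {ξ}) ∪
            {τ ∈ Icc a b | ∃ t ∈ Icc a b, 16 * √(Λ * α) * |t - τ| < |h t - h τ|} := by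
          rintro τ ⟨hτ, hτab⟩
          have hτ' := hlt τ hτ
          by_cases h1 : τ ≤ a + δ
          · exact Or.inl (Or.inl (Or.inl ⟨hτab.1, h1⟩))
          by_cases h2 : b - δ ≤ τ
          · exact Or.inl (Or.inl (Or.inr ⟨h2, hτab.2⟩))
          by_cases h3 : τ = ξ
          · exact Or.inl (Or.inr h3)
          push Not at h1 h2
          obtain ⟨t, ht, hlt'⟩ := H τ ⟨h1, h2⟩ h3 (hαc.le.trans hτ'.le)
          refine Or.inr ⟨hτab, t, ht, lt_of_le_of_lt ?_ hlt'⟩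
          gcongr
        calc volume.restrict (Icc a b) {x | α < g x}
            = volume ({x | α < g x} ∩ Icc a b) := Measure.restrict_apply' measurableSet_Icc
          _ ≤ volume (Icc a (a + δ) ∪ Icc (b - δ) b ∪ {ξ}) + volume
              {τ ∈ Icc a b | ∃ t ∈ Icc a b, 16 * √(Λ * α) * |t - τ| < |h t - h τ|} :=
              (measure_mono hsub).trans (measure_union_le _ _)
          _ ≤ ENNReal.ofReal (2 * δ) + ENNReal.ofReal (7 / 32 * V * (√(Λ * α))⁻¹) := by
              gcongr
              · refine (measure_union_le _ _).trans ?_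
                rw [Real.volume_singleton, add_zero]
                refine (measure_union_le _ _).trans ?_
                rw [Real.volume_Icc, Real.volume_Icc, ← ENNReal.ofReal_add (by linarith)
                  (by linarith)]
                apply ENNReal.ofReal_le_ofReal
                linarith
              · refine (volume_setOf_lt_slope_le hh hβ).trans ?_
                rw [hVen, ← ENNReal.ofReal_mul (by positivity)]
                apply ENNReal.ofReal_le_ofReal
                apply le_of_eq
                have := (Real.sqrt_pos.2 (mul_pos hΛ hα')).ne'
                field_simp
                ring
          _ ≤ ENNReal.ofReal (G α) := by
              rw [← ENNReal.ofReal_add (by positivity) (by positivity)]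
              apply ENNReal.ofReal_le_ofReal
              have := hi0 α
              simp only [hG]
              linarith
    · push Not at hαΛ
      have : {x | α < g x} = ∅ := by
        refine eq_empty_of_forall_notMem fun x hx => ?_
        have h1 := hlt x hx
        have h2 := deriv_le_of_sub_le hΛ.le hup x
        linarith
      rw [this, measure_empty]
      exact zero_le
  have hsqrt := integral_inv_sqrt hΛ
  have hI1 : IntegrableOn ((Ioc 0 c).indicator (fun _ => b - a)) (Ioc 0 Λ) :=
    (integrable_const _).indicator measurableSet_Ioc
  have hI2 : IntegrableOn (fun _ => 2 * δ) (Ioc 0 Λ) := integrable_const _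
  have hGint : IntegrableOn G (Ioc 0 Λ) := (hI1.add hI2).add (hsqrt.1.const_mul _)
  have hGval : ∫ α in Ioc 0 Λ, G α ≤ c * (b - a) + 2 * δ * Λ + 7 / 16 * V := by
    have h1 : ∫ α in Ioc 0 Λ, (Ioc 0 c).indicator (fun _ => b - a) α ≤ c * (b - a) := by
      rw [setIntegral_indicator measurableSet_Ioc, setIntegral_const, smul_eq_mul]
      refine mul_le_mul_of_nonneg_right ?_ (by linarith)
      calc volume.real (Ioc 0 Λ ∩ Ioc 0 c) ≤ volume.real (Ioc 0 c) :=
            measureReal_mono inter_subset_right (by simp)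
        _ = c := by simp [hc]
    have h2 : ∫ α in Ioc 0 Λ, G α = (∫ α in Ioc 0 Λ, (Ioc 0 c).indicator (fun _ => b - a) α) +
        2 * δ * Λ + 7 / 32 * V * 2 := by
      have h3 : ∫ α in Ioc 0 Λ, 7 / 32 * V * (√(Λ * α))⁻¹ = 7 / 32 * V * 2 := by
        rw [integral_const_mul, hsqrt.2]
      have h4 : ∫ _ in Ioc 0 Λ, 2 * δ = 2 * δ * Λ := by
        simp [hΛ.le, mul_comm Λ]
      rw [← h3, ← h4]
      exact (integral_add (hI1.add hI2) (hsqrt.1.const_mul _)).trans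
        (congrArg (· + _) (integral_add hI1 hI2))
    linarith
  have hGnn : ∀ α, 0 ≤ G α := fun α => by
    have := hi0 α
    simp only [hG]
    positivity
  have hfinal : ENNReal.ofReal (∫ x in Icc a b, g x) ≤ ENNReal.ofReal (∫ α in Ioc 0 Λ, G α) := by
    rw [hcake, ofReal_integral_eq_lintegral_ofReal hGint (ae_of_all _ hGnn)]
    refine (setLIntegral_mono' measurableSet_Ioi hpt).trans ?_
    rw [lintegral_indicator measurableSet_Ioc]
    exact lintegral_mono' (Measure.restrict_mono_measure Measure.restrict_le_self _) le_rfl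
  rw [ENNReal.ofReal_le_ofReal_iff (integral_nonneg hGnn), hgeq] at hfinal
  have := neg_abs_le (h b - h a)
  linarith

/-! ### Broken lines and the size of their velocities. -/

/-- The broken line through the origin at time `ξ` with velocity `v` before and `w` after. -/
noncomputable def brokenLine {E : Type*} [AddCommGroup E] [Module ℝ E] (ξ : ℝ) (v w : E) (t : ℝ) : E :=
  if t ≤ ξ then (t - ξ) • v else (t - ξ) • w

theorem brokenLine_sub_smul {E : Type*} [AddCommGroup E] [Module ℝ E] (ξ : ℝ) (v w e : E) (t : ℝ) :
    brokenLine ξ (v - e) (w - e) t = brokenLine ξ v w t - (t - ξ) • e := by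
  unfold brokenLine
  split_ifs <;> rw [smul_sub]

theorem norm_brokenLine_sub_le {E : Type*} [NormedAddCommGroup E] [NormedSpace ℝ E] (ξ : ℝ)
    {v w : E} {C : ℝ} (hv : ‖v‖ ≤ C) (hw : ‖w‖ ≤ C) (a b : ℝ) :
    ‖brokenLine ξ v w b - brokenLine ξ v w a‖ ≤ C * |b - a| := by
  wlog hab : a ≤ b generalizing a b
  · rw [norm_sub_rev, abs_sub_comm]
    exact this b a (le_of_not_ge hab)
  have hC : 0 ≤ C := (norm_nonneg v).trans hv
  rw [abs_of_nonneg (sub_nonneg.2 hab)]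
  unfold brokenLine
  split_ifs with hb ha ha
  · rw [← sub_smul, norm_smul, sub_sub_sub_cancel_right, Real.norm_eq_abs,
      abs_of_nonneg (sub_nonneg.2 hab), mul_comm]
    gcongr
  · exact absurd (hab.trans hb) ha
  · refine (norm_sub_le _ _).trans ?_
    rw [norm_smul, norm_smul, Real.norm_eq_abs, Real.norm_eq_abs, abs_of_nonneg (by linarith),
      abs_of_nonpos (by linarith)]
    have h1 := mul_le_mul_of_nonneg_left hw (show 0 ≤ b - ξ by linarith)
    have h2 := mul_le_mul_of_nonneg_left hv (show 0 ≤ -(a - ξ) by linarith)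
    linarith
  · rw [← sub_smul, norm_smul, sub_sub_sub_cancel_right, Real.norm_eq_abs,
      abs_of_nonneg (sub_nonneg.2 hab), mul_comm]
    gcongr

theorem brokenLine_eventually_affine {E : Type*} [AddCommGroup E] [Module ℝ E] {ξ τ : ℝ}
    (v w : E) (h : τ ≠ ξ) :
    ∃ u : E, (u = v ∨ u = w) ∧ ∀ᶠ t in nhds τ,
      brokenLine ξ v w t = brokenLine ξ v w τ + (t - τ) • u := by
  rcases lt_or_gt_of_ne h with h | h
  · refine ⟨v, Or.inl rfl, ?_⟩
    filter_upwards [Iio_mem_nhds h] with t ht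
    rw [brokenLine, brokenLine, if_pos (le_of_lt ht), if_pos h.le, ← add_smul]
    congr 1; ring
  · refine ⟨w, Or.inr rfl, ?_⟩
    filter_upwards [Ioi_mem_nhds h] with t ht
    rw [brokenLine, brokenLine, if_neg (not_le.2 ht), if_neg (not_le.2 h), ← add_smul]
    congr 1; ring

/-- Controls both velocities of the broken line: `w` is the displacement over a time `d ≥ s / 2`,
and `w₀` is its unperturbed version. Dividing by `d` at most doubles errors measured in units of
`s`. -/
theorem norm_inv_smul_bounds {E : Type*} [NormedAddCommGroup E] [NormedSpace ℝ E] {r s d : ℝ}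
    {e w w₀ : E} (hr : 0 < r) (hr' : r ≤ 1 / 3) (hs : 0 < s) (hd : s / 2 ≤ d)
    (hw : ‖w - w₀‖ ≤ (r ^ 2 / 16 + r ^ 4 / 320) * s) (hw₀ : ‖w₀ - d • e‖ ≤ r * s)
    (hn : ‖w₀‖ ≤ (1 + r ^ 2 / 4) * d) :
    ‖d⁻¹ • w - e‖ ≤ 3 * r ∧ ‖d⁻¹ • w‖ ≤ 1 + r ^ 2 / 2 := by
  have hd0 : 0 < d := by linarith
  have hr2 : r ^ 2 ≤ r / 3 := by nlinarith
  have hr4 : r ^ 4 ≤ r ^ 2 := by nlinarith [sq_nonneg r, sq_nonneg (r ^ 2)]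
  have h1 : d⁻¹ • w - e = d⁻¹ • (w - d • e) := by
    rw [smul_sub, smul_smul, inv_mul_cancel₀ hd0.ne', one_smul]
  rw [h1, norm_smul, norm_smul, norm_inv, Real.norm_eq_abs, abs_of_pos hd0, inv_mul_le_iff₀ hd0,
    inv_mul_le_iff₀ hd0]
  have h2 : ‖w - d • e‖ ≤ ‖w - w₀‖ + ‖w₀ - d • e‖ := norm_sub_le_norm_sub_add_norm_sub _ _ _
  have h3 : ‖w‖ ≤ ‖w - w₀‖ + ‖w₀‖ := norm_le_norm_sub_add _ _
  have h4 : (r ^ 2 / 16 + r ^ 4 / 320) * s ≤ r ^ 2 / 8 * s := by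
    apply mul_le_mul_of_nonneg_right _ hs.le
    linarith [sq_nonneg r]
  have h5 : r ^ 2 * s ≤ r ^ 2 * (2 * d) := by gcongr; linarith
  have h6 : r * s ≤ r * (2 * d) := by gcongr; linarith
  have h7 : r ^ 2 * s ≤ r / 3 * s := by gcongr
  have h8 : 0 < r * d := by positivity
  constructor <;> linarith

/-! ### From slopes along the curve to increments in direction `e`. -/

/-- Comparison of increments of `f` at a point of a curve close to the line `t ↦ x + t • e` with
its increments at `x`, in the direction `e`. -/
theorem abs_sub_increment_le {E : Type*} [NormedAddCommGroup E] [NormedSpace ℝ E] {f : E → ℝ}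
    {M r s p A τ : ℝ} {x e : E} {γ : ℝ → E} (hM : 0 < M) (hr : 0 < r) (hr' : r ≤ 1 / 240)
    (hs : 0 < s) (he : ‖e‖ = 1) (hA : 0 ≤ A) (hf : ∀ y z, |f y - f z| ≤ M * ‖y - z‖)
    (happrox : ∀ t : ℝ, |t| ≤ 7 / 5 * s / r →
      |f (x + t • e) - f x - p * t| ≤ r ^ 4 * M / 160 * |t|)
    (hγ : ∀ a b, ‖γ b - γ a - (b - a) • e‖ ≤ 3 * r * |b - a|)
    (hγs : ∀ q : ℝ, |q| = s → ‖γ q - q • e‖ ≤ r ^ 4 / 320 * s)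
    (hτ : τ ∈ Set.Ioo (-s + 5 * r ^ 2 * s) (s - 5 * r ^ 2 * s))
    (hslope : ∀ t ∈ Set.Icc (-s) s,
      |(f (x + γ t) - p * t) - (f (x + γ τ) - p * τ)| ≤ A * |t - τ|) (t : ℝ) :
    |(f (x + γ τ + t • e) - f (x + γ τ)) - (f (x + t • e) - f x)| ≤ (A + 4 * r * M) * |t| := by
  have hr4 : r ^ 4 ≤ r / 240 := by
    have h1 : r ^ 3 ≤ (1 / 240) ^ 3 := by gcongr
    have h2 : r ^ 4 = r * r ^ 3 := by ring
    nlinarith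
  have hr2 : 0 < r ^ 2 := by positivity
  have hδ : 0 < 5 * r ^ 2 * s := by positivity
  obtain ⟨hτ1, hτ2⟩ := hτ
  have hτs : |τ| ≤ s := abs_le.2 ⟨by linarith, by linarith⟩
  -- For large `|t|` the shift `γ τ`, of norm at most `1.03 s`, is itself of order `r |t|`, so the
  -- Lipschitz bound suffices. For small `|t|` both increments are compared with `p * t`.
  rcases le_or_gt (7 / 10 * s / r) |t| with ht | ht
  · have h1 : ‖γ τ‖ ≤ 103 / 100 * s := by
      have h2 := hγ s τ
      have h3 := hγs s (abs_of_pos hs)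
      have h4 : γ τ = (γ τ - γ s - (τ - s) • e) + (γ s - s • e) + τ • e := by
        rw [sub_smul]; abel
      have h5 : |τ - s| ≤ 2 * s := by rw [abs_of_nonpos (by linarith)]; linarith
      have h6 : 3 * r * |τ - s| ≤ 3 * (1 / 240) * (2 * s) := by gcongr
      have h7 : r ^ 4 / 320 * s ≤ 1 / 240 / 240 / 320 * s := by
        gcongr; linarith
      rw [h4]
      refine (norm_add₃_le).trans ?_
      rw [norm_smul, he, mul_one, Real.norm_eq_abs]
      linarith
    have h2 := hf (x + γ τ + t • e) (x + t • e)
    rw [show x + γ τ + t • e - (x + t • e) = γ τ by abel] at h2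
    have h3 := hf (x + γ τ) x
    rw [show x + γ τ - x = γ τ by abel] at h3
    have h4 : M * ‖γ τ‖ ≤ M * (103 / 100 * s) := by gcongr
    have h5 : s ≤ 10 / 7 * (r * |t|) := by
      rw [div_le_iff₀ hr] at ht
      linarith
    have h6 : M * s ≤ M * (10 / 7 * (r * |t|)) := by gcongr
    have h7 : 0 ≤ A * |t| := by positivity
    have h8 : 0 ≤ M * (r * |t|) := by positivity
    rw [abs_le] at *
    constructor <;> linarith
  · have hρ : s / r * 7 / 10 + s ≤ 7 / 5 * s / r := by
      have : s ≤ s / r * (1 / 240) := by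
        rw [div_mul_eq_mul_div, le_div_iff₀ hr]; gcongr
      have h2 : 7 / 5 * s / r = 7 / 5 * (s / r) := by ring
      have h3 : 0 < s / r := by positivity
      linarith
    have ht' : |t| ≤ s / r * 7 / 10 := by
      refine ht.le.trans (le_of_eq ?_); ring
    have h0 := happrox t (by linarith)
    have hkey : |f (x + γ τ + t • e) - f (x + γ τ) - p * t| ≤ (A + 7 / 2 * r * M) * |t| := by
      by_cases hin : τ + t ∈ Set.Icc (-s) s
      · have h1 := hslope _ hin
        have h2 := hf (x + γ τ + t • e) (x + γ (τ + t))
        rw [norm_sub_rev] at h2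
        have h3 := hγ τ (τ + t)
        rw [show x + γ (τ + t) - (x + γ τ + t • e) = γ (τ + t) - γ τ - t • e by abel] at h2
        rw [add_sub_cancel_left] at h1 h3
        have h4 := mul_le_mul_of_nonneg_left h3 hM.le
        have h5 : 0 ≤ r * M * |t| := by positivity
        rw [abs_le] at *
        constructor <;> linarith
      -- When `τ + t` leaves `[-s, s]`, the comparison passes through the endpoint `q` crossed on
      -- the way. The margin `5 r² s` lets the endpoint errors, of order `r⁴ M s`, be absorbed into
      -- `r M |t|`.
      · obtain ⟨q, hq, hqτ, hqt⟩ : ∃ q : ℝ, |q| = s ∧ |q - τ| ≤ |t| ∧ 5 * r ^ 2 * s ≤ |t| := by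
          rcases lt_or_ge (τ + t) (-s) with h | h
          · refine ⟨-s, by rw [abs_neg, abs_of_pos hs], ?_, ?_⟩
            · rw [abs_of_nonpos (by linarith), abs_of_nonpos (by linarith)]; linarith
            · rw [abs_of_nonpos (by linarith)]; linarith
          · have h' : s < τ + t := by
              by_contra h'
              exact hin ⟨h, not_lt.1 h'⟩
            refine ⟨s, abs_of_pos hs, ?_, ?_⟩
            · rw [abs_of_nonneg (by linarith), abs_of_nonneg (by linarith)]; linarith
            · rw [abs_of_nonneg (by linarith)]; linarith
        have hqγ := hγs q hq
        have hτt : |τ + t| ≤ s + |t| := (abs_add_le _ _).trans (by linarith)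
        have h1 := happrox (τ + t) (by linarith)
        have h2 := happrox q (by rw [hq]; linarith [abs_nonneg t])
        rw [hq] at h2
        have h3 := hslope q (abs_le.1 hq.le)
        have h4 := hf (x + γ τ + t • e) (x + (τ + t) • e)
        have h5 : ‖x + γ τ + t • e - (x + (τ + t) • e)‖ ≤ 3 * r * |t| + r ^ 4 / 320 * s := by
          have h6 : x + γ τ + t • e - (x + (τ + t) • e) =
              (γ q - q • e) - (γ q - γ τ - (q - τ) • e) := by
            rw [add_smul, sub_smul]; abel
          rw [h6]
          refine (norm_sub_le _ _).trans ?_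
          have h7 : 3 * r * |q - τ| ≤ 3 * r * |t| := by gcongr
          linarith [hγ τ q]
        have h6 := hf (x + γ q) (x + q • e)
        rw [add_sub_add_left_eq_sub] at h6
        have h7 := mul_le_mul_of_nonneg_left h5 hM.le
        have h8 := mul_le_mul_of_nonneg_left hqγ hM.le
        have h9 : A * |q - τ| ≤ A * |t| := by gcongr
        have h10 : r ^ 4 * M / 160 * |τ + t| ≤ r ^ 4 * M / 160 * (s + |t|) := by gcongr
        have h11 : r ^ 4 * M * s ≤ M * (r * |t|) / 1200 := by
          have := mul_le_mul_of_nonneg_left hqt (show 0 ≤ M * r ^ 2 / 5 by positivity)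
          have h12 : M * r * |t| * r ≤ M * r * |t| * (1 / 240) := by gcongr
          linarith
        have h13 : r ^ 4 * (M * |t|) ≤ r / 240 * (M * |t|) := by gcongr
        have h14 : 0 ≤ M * (r * |t|) := by positivity
        rw [abs_le] at *
        constructor <;> linarith
    have h13 : r ^ 4 * (M * |t|) ≤ r / 240 * (M * |t|) := by gcongr
    have h14 : 0 ≤ M * (r * |t|) := by positivity
    rw [abs_le] at *
    constructor <;> linarith

/-- Differentiability of `f` along the broken line from `x - s₁` through `x + l'` to `x + s₂`, at a
point of that line where the derivative exceeds `p` and the increments of `f` in the direction `e`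
are close to those at `x`. -/
theorem exists_hasLineDerivAt_on_brokenLine {H : Type*} [NormedAddCommGroup H] [NormedSpace ℝ H]
    {f : H → ℝ} {M r s p ξ : ℝ} {x e l s₁ s₂ l' : H} (hM : 0 < M) (hr : 0 < r) (hr' : r ≤ 1 / 240)
    (hs : 0 < s) (he : ‖e‖ = 1) (hp : 0 ≤ p) (hf : ∀ y z, |f y - f z| ≤ M * ‖y - z‖)
    (happrox : ∀ t : ℝ, |t| ≤ 7 / 5 * s / r →
      |f (x + t • e) - f x - p * t| ≤ r ^ 4 * M / 160 * |t|)
    (hξ : ξ ∈ Set.Ioo (-s / 2) (s / 2))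
    (hincr : 240 * (r ^ 2 * M) * s ≤ |f (x + l) - f (x + ξ • e)|)
    (hl : ‖l - ξ • e‖ ≤ r * s)
    (hslope₁ : ‖s • e + l‖ ≤ (1 + r ^ 2 / 4) * (ξ + s))
    (hslope₂ : ‖s • e - l‖ ≤ (1 + r ^ 2 / 4) * (s - ξ))
    (hs₁ : ‖s₁ - s • e‖ ≤ r ^ 4 / 320 * s) (hs₂ : ‖s₂ - s • e‖ ≤ r ^ 4 / 320 * s)
    (hl' : ‖l' - l‖ ≤ r ^ 2 / 16 * s) :
    ∃ x' ∈ segment ℝ (x - s₁) (x + l') ∪ segment ℝ (x + l') (x + s₂), ∃ (v : H) (u : ℝ),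
      HasLineDerivAt ℝ f (u + p) x' v ∧ ‖v‖ ≤ 1 + r ^ 2 / 2 ∧ 3 * r ^ 2 * M ≤ u ∧
      ∀ t : ℝ, |(f (x' + t • e) - f x') - (f (x + t • e) - f x)| ≤
        (16 * √(M * (1 + r ^ 2 / 2) * u) + 4 * r * M) * |t| := by
  obtain ⟨hξ1, hξ2⟩ := hξ
  have hd₁ : 0 < ξ + s := by linarith
  have hd₂ : 0 < s - ξ := by linarith
  have hr2 : r ^ 2 ≤ 1 / 240 * r := by nlinarith
  have hr4 : r ^ 4 ≤ r ^ 2 / 240 := by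
    have h1 : r ^ 2 * r ^ 2 ≤ r ^ 2 * (1 / 240) := by gcongr; linarith
    linarith
  set v₁ := (ξ + s)⁻¹ • (l' + s₁) with hv₁
  set v₂ := (s - ξ)⁻¹ • (s₂ - l') with hv₂
  obtain ⟨hv₁e, hv₁n⟩ : ‖v₁ - e‖ ≤ 3 * r ∧ ‖v₁‖ ≤ 1 + r ^ 2 / 2 := by
    refine norm_inv_smul_bounds (w₀ := s • e + l) hr (by linarith) hs (by linarith) ?_ ?_ hslope₁
    · rw [show l' + s₁ - (s • e + l) = (l' - l) + (s₁ - s • e) by abel]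
      refine (norm_add_le _ _).trans ?_
      linarith
    · rw [show s • e + l - (ξ + s) • e = l - ξ • e by rw [add_smul]; abel]
      exact hl
  obtain ⟨hv₂e, hv₂n⟩ : ‖v₂ - e‖ ≤ 3 * r ∧ ‖v₂‖ ≤ 1 + r ^ 2 / 2 := by
    refine norm_inv_smul_bounds (w₀ := s • e - l) hr (by linarith) hs (by linarith) ?_ ?_ hslope₂
    · rw [show s₂ - l' - (s • e - l) = (s₂ - s • e) - (l' - l) by abel]
      refine (norm_sub_le _ _).trans ?_
      linarith
    · rw [show s • e - l - (s - ξ) • e = -(l - ξ • e) by rw [sub_smul]; abel, norm_neg]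
      exact hl
  set γ : ℝ → H := fun t => l' + brokenLine ξ v₁ v₂ t with hγdef
  have hγξ : γ ξ = l' := by simp [hγdef, brokenLine]
  have hγl : ∀ t ≤ ξ, γ t = l' + (t - ξ) • v₁ := fun t ht => by
    simp only [hγdef, brokenLine, if_pos ht]
  have hγr : ∀ t, ξ < t → γ t = l' + (t - ξ) • v₂ := fun t ht => by
    simp only [hγdef, brokenLine, if_neg (not_le.2 ht)]
  have hγneg : γ (-s) = -s₁ := by
    rw [hγl _ (by linarith), hv₁, smul_smul, show (-s - ξ) * (ξ + s)⁻¹ = -1 by field_simp; ring]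
    rw [neg_smul, one_smul]; abel
  have hγpos : γ s = s₂ := by
    rw [hγr _ (by linarith), hv₂, smul_smul, mul_inv_cancel₀ hd₂.ne', one_smul]; abel
  have hγe : ∀ a b, ‖γ b - γ a - (b - a) • e‖ ≤ 3 * r * |b - a| := by
    intro a b
    have := norm_brokenLine_sub_le ξ hv₁e hv₂e a b
    rw [brokenLine_sub_smul, brokenLine_sub_smul] at this
    convert this using 2
    simp only [hγdef, sub_smul]; abel
  have hγn : ∀ a b, ‖γ b - γ a‖ ≤ (1 + r ^ 2 / 2) * |b - a| := by
    intro a b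
    have := norm_brokenLine_sub_le ξ hv₁n hv₂n a b
    simpa [hγdef] using this
  have hγs : ∀ q : ℝ, |q| = s → ‖γ q - q • e‖ ≤ r ^ 4 / 320 * s := by
    intro q hq
    rcases eq_or_eq_neg_of_abs_eq hq with rfl | rfl
    · rwa [hγpos]
    · rw [hγneg, show -s₁ - -s • e = -(s₁ - s • e) by rw [neg_smul]; abel, norm_neg]
      exact hs₁
  set Λ := M * (1 + r ^ 2 / 2) with hΛ
  have hΛ0 : 0 < Λ := by positivity
  have hφ : ∀ a b, |f (x + γ b) - f (x + γ a)| ≤ Λ * |b - a| := by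
    intro a b
    refine (hf _ _).trans ?_
    rw [add_sub_add_left_eq_sub, hΛ, mul_assoc]
    gcongr
    exact hγn a b
  -- Removing the slope `p` nearly equalises the end values. Since `p ≥ 0`, the upper slope bound
  -- stays `Λ`.
  set h : ℝ → ℝ := fun t => f (x + γ t) - p * t with hh
  have hLip : LipschitzWith (Λ + p).toNNReal h := by
    refine LipschitzWith.of_dist_le_mul fun a b => ?_
    rw [Real.dist_eq, Real.dist_eq, Real.coe_toNNReal _ (by linarith)]
    have h1 := hφ b a
    have h2 : h a - h b = (f (x + γ a) - f (x + γ b)) - p * (a - b) := by simp only [hh]; ring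
    rw [h2]
    refine (abs_sub _ _).trans ?_
    rw [abs_mul, abs_of_nonneg hp]
    linarith
  have hup : ∀ a b, a ≤ b → h b - h a ≤ Λ * (b - a) := by
    intro a b hab
    have h1 := (le_abs_self _).trans (hφ a b)
    rw [abs_of_nonneg (sub_nonneg.2 hab)] at h1
    have h2 := mul_nonneg hp (sub_nonneg.2 hab)
    simp only [hh]
    linarith
  have hρ : s ≤ 7 / 5 * s / r := by
    rw [le_div_iff₀ hr]; nlinarith
  have hends : ∀ q : ℝ, |q| = s → |h q - f x| ≤ r ^ 4 * M * s / 100 := by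
    intro q hq
    have h1 := happrox q (by rwa [hq])
    have h2 := hf (x + γ q) (x + q • e)
    rw [add_sub_add_left_eq_sub] at h2
    have h3 := mul_le_mul_of_nonneg_left (hγs q hq) hM.le
    have h4 : 0 ≤ r ^ 4 * M * s := by positivity
    rw [hq] at h1
    simp only [hh]
    rw [abs_le] at *
    constructor <;> linarith
  have hmid : 239 * (r ^ 2 * M * s) ≤ |h ξ - f x| := by
    have hξs : |ξ| ≤ s / 2 := abs_le.2 ⟨by linarith, by linarith⟩
    have h1 := happrox ξ (by linarith)
    have h2 := hf (x + l') (x + l)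
    rw [add_sub_add_left_eq_sub] at h2
    have h3 := mul_le_mul_of_nonneg_left hl' hM.le
    have h4 : r ^ 4 * M / 160 * |ξ| ≤ r ^ 2 / 240 * M / 160 * (s / 2) := by gcongr
    have h5 : 0 ≤ r ^ 2 * M * s := by positivity
    have h6 : f (x + l) - f (x + ξ • e) = (h ξ - f x) - (f (x + l') - f (x + l)) -
        (f (x + ξ • e) - f x - p * ξ) := by
      simp only [hh, hγξ]; ring
    rw [h6] at hincr
    have h7 := (abs_sub _ _).trans (add_le_add_left (abs_sub (h ξ - f x) (f (x + l') - f (x + l)))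
      |f (x + ξ • e) - f x - p * ξ|)
    linarith
  -- In units of `r² M s`, the required bound is about `16 * (6 + 10.1)`, below the available `2 *
  -- 239` by enough to absorb the endpoint errors.
  obtain ⟨τ, hτ, hτξ, hu, hgood⟩ := exists_le_deriv_and_slope_le hLip (a := -s) (b := s) (ξ := ξ)
    (c := 3 * r ^ 2 * M) (δ := 5 * r ^ 2 * s) ⟨by linarith, by linarith⟩ (by positivity)
    (by positivity) hΛ0 hup (by
      have h1 := hends s (abs_of_pos hs)
      have h2 := hends (-s) (by rw [abs_neg, abs_of_pos hs])
      have h3 : 0 < r ^ 2 * M * s := by positivity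
      have h4 : r ^ 4 * (M * s) ≤ r ^ 2 / 240 * (M * s) := by gcongr
      have h5 := abs_sub_le (h s) (f x) (h (-s))
      rw [abs_sub_comm (f x)] at h5
      have h6 := abs_sub_le (h ξ) (h s) (f x)
      have h7 := abs_sub_le (h ξ) (h (-s)) (f x)
      have h8 : 5 * r ^ 2 * s * Λ ≤ 5 * r ^ 2 * s * (M * (101 / 100)) := by
        have h9 : 1 + r ^ 2 / 2 ≤ 101 / 100 := by linarith
        rw [hΛ]; gcongr
      linarith)
  have hu0 : 0 < 3 * r ^ 2 * M := by positivity
  refine ⟨x + γ τ, ?_, ?_⟩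
  · obtain ⟨hτ1, hτ2⟩ := hτ
    have hδ : 0 < 5 * r ^ 2 * s := by positivity
    rcases lt_or_gt_of_ne hτξ with hlt | hlt
    · refine Or.inl ⟨(ξ - τ) / (ξ + s), (τ + s) / (ξ + s), ?_, ?_, ?_, ?_⟩
      · exact div_nonneg (by linarith) hd₁.le
      · exact div_nonneg (by linarith) hd₁.le
      · field_simp; ring
      · rw [hγl τ hlt.le, hv₁]
        match_scalars <;> field_simp <;> ring
    · refine Or.inr ⟨(s - τ) / (s - ξ), (τ - ξ) / (s - ξ), ?_, ?_, ?_, ?_⟩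
      · exact div_nonneg (by linarith) hd₂.le
      · exact div_nonneg (by linarith) hd₂.le
      · field_simp; ring
      · rw [hγr τ hlt, hv₂]
        match_scalars <;> field_simp <;> ring
  · obtain ⟨v, hv, hev⟩ := brokenLine_eventually_affine v₁ v₂ hτξ
    -- `deriv` defaults to 0, so its positive lower bound forces differentiability.
    have hdiff : DifferentiableAt ℝ h τ := by
      by_contra hnd
      rw [deriv_zero_of_not_differentiableAt hnd] at hu
      linarith
    refine ⟨v, deriv h τ, ?_, ?_, hu, ?_⟩
    · have h1 : HasDerivAt (fun t => f (x + γ t)) (deriv h τ + p) τ := by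
        have h2 := hdiff.hasDerivAt.add ((hasDerivAt_id τ).const_mul p)
        rw [mul_one] at h2
        refine h2.congr_of_eventuallyEq (Filter.Eventually.of_forall fun t => ?_)
        simp [hh]
      have h3 : HasDerivAt (fun t => f (x + γ τ + (t - τ) • v)) (deriv h τ + p) τ := by
        refine h1.congr_of_eventuallyEq ?_
        filter_upwards [hev] with t ht
        simp only [hγdef, ht]
        congr 1; abel
      unfold HasLineDerivAt
      have h4 := h3
      rw [← zero_add τ] at h4
      have h5 := h4.comp_add_const 0 τ
      simpa using h5
    · rcases hv with rfl | rfl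
      exacts [hv₁n, hv₂n]
    · exact abs_sub_increment_le hM hr hr' hs he (by positivity) hf happrox hγe hγs hτ hgood

/-! ### Rescaling by `r` and normalising the direction. -/

theorem mainTheorem5 {H : Type*} [NormedAddCommGroup H] [InnerProductSpace ℝ H] [CompleteSpace H]
    (f : H → ℝ) (hf : ∃ K : ℝ≥0, LipschitzWith K f) (hLip : 0 < lipConst f)
    (ε : ℝ) (hε : ε ∈ Set.Ioo 0 (lipConst f / 9))
    (x e : H) (he : e ∈ Metric.sphere (0 : H) 1) (s : ℝ) (hs : 0 < s)
    (hdiff : LineDifferentiableAt ℝ f x e) (hnonneg : 0 ≤ lineDeriv ℝ f x e)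
    (happrox : ∀ t : ℝ, |t| ≤ s * √(2 * lipConst f / ε) →
      |f (x + t • e) - f x - lineDeriv ℝ f x e * t| ≤ ε ^ 2 / (160 * lipConst f) * |t|)
    (ξ : ℝ) (hξ : ξ ∈ Set.Ioo (-s / 2) (s / 2)) (l : H)
    (hincr : 240 * ε * s ≤ |f (x + l) - f (x + ξ • e)|)
    (hl : ‖l - ξ • e‖ ≤ s * √(ε / lipConst f))
    (hslope : ∀ π : ℝ, π = 1 ∨ π = -1 →
      ‖(π * s) • e + l‖ / |π * s + ξ| ≤ 1 + ε / (4 * lipConst f))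
    (s₁ s₂ l' : H)
    (hs₁₂ : max ‖s₁ - s • e‖ ‖s₂ - s • e‖ ≤ ε ^ 2 / (320 * lipConst f ^ 2) * s)
    (hl' : ‖l' - l‖ ≤ ε * s / (16 * lipConst f)) :
    ∃ x' ∈ segment ℝ (x - s₁) (x + l') ∪ segment ℝ (x + l') (x + s₂),
      ∃ e' ∈ Metric.sphere (0 : H) 1,
        LineDifferentiableAt ℝ f x' e' ∧
        lineDeriv ℝ f x e + ε ≤ lineDeriv ℝ f x' e' ∧
        ∀ t : ℝ, |(f (x' + t • e) - f x') - (f (x + t • e) - f x)| ≤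
          25 * √((lineDeriv ℝ f x' e' - lineDeriv ℝ f x e) * lipConst f) * |t| := by
  obtain ⟨K, hK⟩ := hf
  have hfM : ∀ y z, |f y - f z| ≤ lipConst f * ‖y - z‖ := (isLeast_lipConst hK).1.2
  generalize lipConst f = M at *
  generalize lineDeriv ℝ f x e = p at *
  obtain ⟨hε0, hε9⟩ := hε
  have he1 : ‖e‖ = 1 := by simpa using he
  set r := √(ε / M) with hr
  have hr0 : 0 < r := Real.sqrt_pos.2 (div_pos hε0 hLip)
  have hr2 : r ^ 2 = ε / M := Real.sq_sqrt (div_pos hε0 hLip).le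
  have hεr : ε = r ^ 2 * M := by rw [hr2]; field_simp
  -- Smallness is automatic: the two bounds on `λ` give `240 r² M s ≤ M r s`.
  have hr240 : r ≤ 1 / 240 := by
    have h1 := hfM (x + l) (x + ξ • e)
    rw [add_sub_add_left_eq_sub] at h1
    have h2 := mul_le_mul_of_nonneg_left hl hLip.le
    have h3 : (240 * r) * (M * r * s) ≤ 1 * (M * r * s) := by
      rw [hεr] at hincr
      linarith
    have := le_of_mul_le_mul_right h3 (by positivity)
    linarith
  -- 7/5 is a rational number below `√2`.
  have hρ : 7 / 5 * s / r ≤ s * √(2 * M / ε) := by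
    have h1 : 7 / 5 / r ≤ √(2 * M / ε) := by
      apply Real.le_sqrt_of_sq_le
      rw [hεr, div_pow, div_le_div_iff₀ (by positivity) (by positivity)]
      have : 0 < M * r ^ 2 := by positivity
      linarith
    calc 7 / 5 * s / r = s * (7 / 5 / r) := by ring
      _ ≤ _ := by gcongr
  obtain ⟨hξ1, hξ2⟩ := hξ
  have hε4 : ε / (4 * M) = r ^ 2 / 4 := by rw [hr2]; field_simp
  obtain ⟨x', hx', v, u, hline, hvn, hu, hinc⟩ :=
    exists_hasLineDerivAt_on_brokenLine (p := p) (x := x) (e := e) (l := l) (s₁ := s₁) (s₂ := s₂)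
      (l' := l') (ξ := ξ) hLip hr0 hr240 hs he1 hnonneg hfM
      (fun t ht => by
        refine (happrox t (ht.trans hρ)).trans (le_of_eq ?_)
        rw [hεr]; field_simp)
      ⟨hξ1, hξ2⟩ (by rwa [← hεr]) (by rwa [mul_comm])
      (by
        have := hslope 1 (Or.inl rfl)
        rwa [one_mul, abs_of_pos (by linarith), div_le_iff₀ (by linarith), hε4,
          add_comm s ξ] at this)
      (by
        have := hslope (-1) (Or.inr rfl)
        rw [abs_of_neg (by linarith), div_le_iff₀ (by linarith), hε4, ← norm_neg,
          show -((-1 * s) • e + l) = s • e - l by rw [neg_one_mul, neg_smul]; abel] at this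
        linarith)
      (((le_max_left _ _).trans hs₁₂).trans (le_of_eq (by rw [hεr]; field_simp)))
      (((le_max_right _ _).trans hs₁₂).trans (le_of_eq (by rw [hεr]; field_simp)))
      (hl'.trans (le_of_eq (by rw [hεr]; field_simp)))
  have hu0 : 0 < u := lt_of_lt_of_le (by positivity) hu
  have hv0 : v ≠ 0 := by
    rintro rfl
    have h1 : HasLineDerivAt ℝ f 0 x' 0 := hasLineDerivAt_zero
    have h2 := h1.unique hline
    linarith
  have hN : 0 < ‖v‖ := norm_pos_iff.2 hv0
  set e' := ‖v‖⁻¹ • v with he'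
  have he'n : ‖e'‖ = 1 := norm_smul_inv_norm (𝕜 := ℝ) hv0
  have hline' : HasLineDerivAt ℝ f (‖v‖⁻¹ • (u + p)) x' e' := hline.smul _
  set q := ‖v‖⁻¹ • (u + p) with hq
  have hqv : q * ‖v‖ = u + p := by
    rw [hq, smul_eq_mul]; field_simp
  have hq0 : 0 < q := by rw [hq, smul_eq_mul]; positivity
  have hqM : q ≤ M := by
    have := hline'.le_of_lip' hLip.le (Filter.Eventually.of_forall fun y => hfM y x')
    rw [he'n, mul_one, Real.norm_eq_abs, abs_of_pos hq0] at this
    exact this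
  -- As `q ≤ M`, normalising loses at most `M r²/2 = ε/2`, which is at most `u/6`. Hence `q - p ≥
  -- 5u/6 ≥ 5ε/2`.
  have hqu : u + p ≤ q + M * (r ^ 2 / 2) := by
    have h1 : q * ‖v‖ ≤ q * (1 + r ^ 2 / 2) := by gcongr
    have h2 : q * (r ^ 2 / 2) ≤ M * (r ^ 2 / 2) := by gcongr
    linarith
  have hr2M : 0 < r ^ 2 * M := by positivity
  refine ⟨x', hx', e', by simpa using he'n, hline'.lineDifferentiableAt, ?_, fun t => ?_⟩
  · rw [hline'.lineDeriv, hεr]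
    linarith
  · rw [hline'.lineDeriv]
    refine (hinc t).trans ?_
    have hrs : r ^ 2 ≤ 1 / 100 := by nlinarith
    -- The final constant is `16 * 6/5 + 4 = 23.2 ≤ 25`.
    have h1 : √(M * (1 + r ^ 2 / 2) * u) ≤ 6 / 5 * √((q - p) * M) := by
      rw [← Real.sqrt_sq (show (0 : ℝ) ≤ 6 / 5 by norm_num), ← Real.sqrt_mul (by positivity)]
      apply Real.sqrt_le_sqrt
      have h2 : M * (1 + r ^ 2 / 2) * u ≤ M * (101 / 100) * (6 / 5 * (q - p)) := by
        have h3 : 1 + r ^ 2 / 2 ≤ 101 / 100 := by linarith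
        have h4 : u ≤ 6 / 5 * (q - p) := by linarith
        gcongr
      have h3 : 0 ≤ M * (q - p) := mul_nonneg hLip.le (by linarith)
      linarith
    have h2 : r * M ≤ √((q - p) * M) := by
      apply Real.le_sqrt_of_sq_le
      rw [mul_pow, sq M, ← mul_assoc]
      gcongr
      linarith
    gcongr
    linarith [Real.sqrt_nonneg ((q - p) * M)]
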